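/- For $\delta\in(0,1/2]$ with $\delta\,(\log_2(1/\delta))^2\le 2^{-16}$ put $\delta'=\delta/(256\log_2(1/\delta))^2$, and let $\mathcal C_\delta$ be the class of all bilinear forms $f(\mathbf x,\mathbf y)=\mathbf x^{\top}A\,\mathbf y$ on $\mathbb F_2^n\times\mathbb F_2^n$ ($n\in\mathbb N$), seen as Boolean functions on $2n$ variables, where $A\in\mathbb F_2^{n\times n}$ is a matrix such that every $k\times k$ submatrix of $A$ (arbitrary rows and columns) with $k\ge\delta n$ has rank at least $\delta' n$. A circuit in negation normal form (NNF) is a single-output Boolean circuit whose input gates are labelled with variables or negated variables and whose internal gates are fanin-2 AND- and OR-gates; its size is its number of gates. A d-DNNF is an NNF in which the two subcircuits rooted at the inputs of any AND-gate have no variable in common, and the two subcircuits rooted at the inputs of any OR-gate accept disjoint sets of assignments. A Boolean function $\tilde f$ is a weak $\varepsilon$-approximation of $f$ (with respect to the uniform distribution on assignments) if $\Pr_{\mathbf z}[f(\mathbf z)\neq\tilde f(\mathbf z)]\le\varepsilon$. Theorem. Let $0\le\varepsilon<1/2$, and let $\delta$ be as above (such $\delta$ exist). Then: (1) the class $\mathcal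 C_\delta$ is exponentially large: there are $c>0$ and $n_0$ such that for every $n\ge n_0$ it contains at least $2^{cn}$ functions on $2n$ variables; (2) every d-DNNF computing a weak $\varepsilon$-approximation of a function in $\mathcal C_\delta$ on $N=2n$ variables has size $2^{\Omega(N)}$: there are $c>0$ and $n_0$, depending only on $\varepsilon$ and $\delta$, such that for every $n\ge n_0$, every $f\in\mathcal C_\delta$ on $2n$ variables and every weak $\varepsilon$-approximation $\tilde f$ of $f$, every d-DNNF representing $\tilde f$ has at least $2^{c\cdot 2n}$ gates. -/

import Mathlib

/-- Assignments of the Boolean variables in `X`, as vectors over the field with two elements. -/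
abbrev Assignment (X : Type*) : Type _ := X → ZMod 2

/-- Boolean functions on the variables in `X`. -/
abbrev BoolFun (X : Type*) : Type _ := Assignment X → ZMod 2

/-- Gates of a circuit in negation normal form over `X`, for a gate whose possible inputs are
the `k` gates that precede it: a variable, a negated variable, or a fanin-2 AND or OR gate. -/
inductive NNFGate (X : Type*) (k : ℕ) where
  | pos (x : X) : NNFGate X k
  | neg (x : X) : NNFGate X k
  | and (l r : Fin k) : NNFGate X k
  | or (l r : Fin k) : NNFGate X k

/-- A single-output circuit in negation normal form over `X`. It is a directed acyclic graph
(gates may be shared), listed in a topological order; `size` is the number of all its gates,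
input gates included. -/
structure NNF (X : Type*) where
  size : ℕ
  gate : (i : Fin size) → NNFGate X i
  output : Fin size

namespace NNF

variable {X : Type*}

/-- An input of gate `i` (one of the preceding gates), seen as a gate of the circuit. -/
def child (C : NNF X) (i : Fin C.size) (j : Fin (i : ℕ)) : Fin C.size :=
  ⟨j, j.isLt.trans i.isLt⟩

/-- The subcircuit rooted at gate `i` accepts the assignment `a`. -/
def AcceptsAt (C : NNF X) (a : Assignment X) (i : Fin C.size) : Prop :=
  match C.gate i with
  | .pos x => a x = 1
  | .neg x => a x = 0
  | .and l r => C.AcceptsAt a (C.child i l) ∧ C.AcceptsAt a (C.child i r)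
  | .or l r => C.AcceptsAt a (C.child i l) ∨ C.AcceptsAt a (C.child i r)
termination_by (i : ℕ)
decreasing_by all_goals simp [child]

/-- The variables `x` such that `x` or its negation labels an input gate of the subcircuit
rooted at gate `i`. -/
def varsAt (C : NNF X) (i : Fin C.size) : Set X :=
  match C.gate i with
  | .pos x => {x}
  | .neg x => {x}
  | .and l r => C.varsAt (C.child i l) ∪ C.varsAt (C.child i r)
  | .or l r => C.varsAt (C.child i l) ∪ C.varsAt (C.child i r)
termination_by (i : ℕ)
decreasing_by all_goals simp [child]

/-- The two subcircuits below any AND gate share no variable. -/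
def IsDecomposable (C : NNF X) : Prop :=
  ∀ (i : Fin C.size) (l r : Fin (i : ℕ)), C.gate i = .and l r →
    Disjoint (C.varsAt (C.child i l)) (C.varsAt (C.child i r))

/-- The two subcircuits below any OR gate accept disjoint sets of assignments. -/
def IsDeterministic (C : NNF X) : Prop :=
  ∀ (i : Fin C.size) (l r : Fin (i : ℕ)), C.gate i = .or l r →
    Disjoint {a : Assignment X | C.AcceptsAt a (C.child i l)}
      {a : Assignment X | C.AcceptsAt a (C.child i r)}

/-- The circuit is a d-DNNF. -/
def IsDDNNF (C : NNF X) : Prop :=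
  C.IsDecomposable ∧ C.IsDeterministic

/-- The circuit represents (encodes) the Boolean function `f`. -/
def Encodes (C : NNF X) (f : BoolFun X) : Prop :=
  ∀ a : Assignment X, C.AcceptsAt a C.output ↔ f a = 1

end NNF

/-- `g` is a weak `ε`-approximation of `f` with respect to the distribution `D` on assignments:
the `D`-probability of the event `f ≠ g` is at most `ε`. -/
def IsWeakApprox {X : Type*} (D : PMF (Assignment X)) (ε : ℝ) (f g : BoolFun X) : Prop :=
  (D.toOuterMeasure {a | f a ≠ g a}).toReal ≤ ε

/-- The uniform distribution on assignments. -/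
noncomputable def uniformDist (X : Type*) [Fintype X] [DecidableEq X] : PMF (Assignment X) :=
  PMF.uniformOfFintype (Assignment X)

/-- The bilinear form `(x, y) ↦ xᵀ A y`, as a Boolean function on `2 n` variables. -/
def bilinearForm {n : ℕ} (A : Matrix (Fin n) (Fin n) (ZMod 2)) : BoolFun (Fin n ⊕ Fin n) :=
  fun z => (fun i => z (Sum.inl i)) ⬝ᵥ A.mulVec (fun j => z (Sum.inr j))

/-- Every square submatrix of `A` of size at least `δ n × δ n` has rank at least `δ' n`,
where `δ' = δ / (256 log₂ (1 / δ)) ^ 2`. -/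
def IsAjtaiMatrix (δ : ℝ) {n : ℕ} (A : Matrix (Fin n) (Fin n) (ZMod 2)) : Prop :=
  ∀ R C : Finset (Fin n), R.card = C.card → δ * n ≤ R.card →
    δ / (256 * Real.logb 2 (1 / δ)) ^ 2 * n ≤
      ((A.submatrix (fun i : R => (i : Fin n)) (fun j : C => (j : Fin n))).rank : ℝ)

/-- The Boolean functions on `2 n` variables that are bilinear forms of Ajtai-type matrices. -/
def ajtaiForms (δ : ℝ) (n : ℕ) : Set (BoolFun (Fin n ⊕ Fin n)) :=
  {f | ∃ A : Matrix (Fin n) (Fin n) (ZMod 2), IsAjtaiMatrix δ A ∧ f = bilinearForm A}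

/-! The lower bound is a discrepancy argument. In a d-DNNF of size `s`, determinism turns OR into a
sum of indicators and AND is a product over disjoint variable sets. Cutting the circuit where the
number of variables below a gate drops to at most two thirds of all variables therefore writes its
indicator as a sum of at most `s ^ 2` products `p * q`, with `p` and `q` bounded by 1 and living on
the two sides of a balanced partition (`NNF.IsDDNNF.exists_balanced_products`).

A balanced partition puts at least `n / 6` rows on one side and as many columns on the other
(`exists_large_cross`). With the other variables fixed, Lindsey's lemma applies to a submatrix of
rank at least `δ' n`, so each product has correlation at most `2 ^ (-δ' n / 2)` with the sign of the
form (`IsAjtaiMatrix.abs_sum_rectangle_le`). A weak `ε`-approximation has correlation at least `1 -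
2 ε`, which forces `s ^ 2` to be exponential.

The class is large because few matrices have low rank: a union bound over the at most `4 ^ n`
choices of rows and columns leaves at least half of all matrices (`card_not_isAjtaiMatrix_le`), and
distinct matrices give distinct forms. -/

namespace NNF

/-! ### Acceptance indicators of gates -/

variable {X : Type*} (C : NNF X)

theorem acceptsAt_dependsOn (i : Fin C.size) :
    DependsOn (fun a => C.AcceptsAt a i) (C.varsAt i) := by
  obtain ⟨i, hi⟩ := i
  induction i using Nat.strong_induction_on with
  | _ i ih =>
    intro a b hab
    rw [varsAt] at hab
    simp only
    rw [AcceptsAt, AcceptsAt]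
    cases h : C.gate ⟨i, hi⟩ with
    | pos x => simp [h] at hab ⊢; simp [hab]
    | neg x => simp [h] at hab ⊢; simp [hab]
    | and l r =>
      simp only [h, Set.mem_union] at hab ⊢
      have hl := ih l l.isLt (l.isLt.trans hi) (fun x hx => hab x (Or.inl hx))
      have hr := ih r r.isLt (r.isLt.trans hi) (fun x hx => hab x (Or.inr hx))
      simp only at hl hr
      simp only [child, hl, hr]
    | or l r =>
      simp only [h, Set.mem_union] at hab ⊢
      have hl := ih l l.isLt (l.isLt.trans hi) (fun x hx => hab x (Or.inl hx))
      have hr := ih r r.isLt (r.isLt.trans hi) (fun x hx => hab x (Or.inr hx))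
      simp only at hl hr
      simp only [child, hl, hr]

open Classical in
/-- The indicator function of the assignments accepted at gate `i`. -/
noncomputable def acceptInd (i : Fin C.size) (a : Assignment X) : ℝ :=
  if C.AcceptsAt a i then 1 else 0

theorem acceptInd_nonneg (i : Fin C.size) (a : Assignment X) : 0 ≤ C.acceptInd i a := by
  unfold acceptInd; split <;> norm_num

theorem acceptInd_le_one (i : Fin C.size) (a : Assignment X) : C.acceptInd i a ≤ 1 := by
  unfold acceptInd; split <;> norm_num

theorem acceptInd_dependsOn (i : Fin C.size) : DependsOn (C.acceptInd i) (C.varsAt i) := by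
  intro a b hab
  have : C.AcceptsAt a i ↔ C.AcceptsAt b i := iff_of_eq (C.acceptsAt_dependsOn i hab)
  by_cases hb : C.AcceptsAt b i
  · rw [acceptInd, acceptInd, if_pos hb, if_pos (this.mpr hb)]
  · rw [acceptInd, acceptInd, if_neg hb, if_neg (mt this.mp hb)]

variable {C}

theorem acceptsAt_and {i : Fin C.size} {l r : Fin (i : ℕ)} (h : C.gate i = .and l r)
    (a : Assignment X) :
    C.AcceptsAt a i ↔ C.AcceptsAt a (C.child i l) ∧ C.AcceptsAt a (C.child i r) := by
  rw [AcceptsAt]; simp only [h]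

theorem acceptsAt_or {i : Fin C.size} {l r : Fin (i : ℕ)} (h : C.gate i = .or l r)
    (a : Assignment X) :
    C.AcceptsAt a i ↔ C.AcceptsAt a (C.child i l) ∨ C.AcceptsAt a (C.child i r) := by
  rw [AcceptsAt]; simp only [h]

theorem acceptInd_and {i : Fin C.size} {l r : Fin (i : ℕ)} (h : C.gate i = .and l r)
    (a : Assignment X) :
    C.acceptInd i a = C.acceptInd (C.child i l) a * C.acceptInd (C.child i r) a := by
  by_cases hl : C.AcceptsAt a (C.child i l) <;> by_cases hr : C.AcceptsAt a (C.child i r) <;>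
    simp [acceptInd, acceptsAt_and h, hl, hr]

theorem acceptInd_or (hC : C.IsDeterministic) {i : Fin C.size} {l r : Fin (i : ℕ)}
    (h : C.gate i = .or l r) (a : Assignment X) :
    C.acceptInd i a = C.acceptInd (C.child i l) a + C.acceptInd (C.child i r) a := by
  have hd : C.AcceptsAt a (C.child i l) → ¬ C.AcceptsAt a (C.child i r) :=
    fun hl hr => Set.disjoint_left.mp (hC i l r h) hl hr
  by_cases hl : C.AcceptsAt a (C.child i l) <;> by_cases hr : C.AcceptsAt a (C.child i r)
  · exact absurd hr (hd hl)
  all_goals simp [acceptInd, acceptsAt_or h, hl, hr]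

theorem varsAt_and {i : Fin C.size} {l r : Fin (i : ℕ)} (h : C.gate i = .and l r) :
    C.varsAt i = C.varsAt (C.child i l) ∪ C.varsAt (C.child i r) := by
  rw [varsAt]; simp only [h]

theorem varsAt_or {i : Fin C.size} {l r : Fin (i : ℕ)} (h : C.gate i = .or l r) :
    C.varsAt i = C.varsAt (C.child i l) ∪ C.varsAt (C.child i r) := by
  rw [varsAt]; simp only [h]

/-! ### Decomposition of a d-DNNF into balanced products -/

variable (C) in
/-- More than two thirds of the variables occur below the gate. -/
def IsHeavy (i : Fin C.size) : Prop := 2 * Nat.card X < 3 * (C.varsAt i).ncard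

variable (C) in
/-- An edge leading from a heavy gate to one that is not heavy. -/
def IsCutEdge (e : Fin C.size × Fin C.size) : Prop :=
  C.IsHeavy e.1 ∧ ¬ C.IsHeavy e.2 ∧ C.varsAt e.2 ⊆ C.varsAt e.1

variable (C) in
/-- `F` is a combination of the acceptance indicators of the lower ends of cut edges inside `S`,
the coefficient of an edge `e` being a nonnegative function of the variables outside `Z e`. -/
def HasCutDecomposition (Z : Fin C.size × Fin C.size → Set X) (S : Set X)
    (F : Assignment X → ℝ) : Prop :=
  ∃ τ : Fin C.size × Fin C.size → Assignment X → ℝ,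
    (∀ a, F a = ∑ e, τ e a * C.acceptInd e.2 a) ∧
    ∀ e, (∀ a, 0 ≤ τ e a) ∧ DependsOn (τ e) (Z e)ᶜ ∧
      (τ e = 0 ∨ C.IsCutEdge e ∧ C.varsAt e.1 ⊆ S)

namespace HasCutDecomposition

variable {Z : Fin C.size × Fin C.size → Set X} {S T : Set X} {F G : Assignment X → ℝ}

theorem add (hF : C.HasCutDecomposition Z S F) (hG : C.HasCutDecomposition Z T G) :
    C.HasCutDecomposition Z (S ∪ T) (fun a => F a + G a) := by
  obtain ⟨τ, h1, h2⟩ := hF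
  obtain ⟨σ, h3, h4⟩ := hG
  refine ⟨fun e a => τ e a + σ e a, fun a => ?_, fun e => ⟨fun a => ?_, fun a b hab => ?_, ?_⟩⟩
  · simp only [h1, h3]
    rw [← Finset.sum_add_distrib]
    exact Finset.sum_congr rfl fun e _ => by ring
  · exact add_nonneg ((h2 e).1 a) ((h4 e).1 a)
  · simp only [(h2 e).2.1 hab, (h4 e).2.1 hab]
  · rcases (h2 e).2.2 with h | ⟨h, hS⟩
    · rcases (h4 e).2.2 with h' | ⟨h', hT⟩
      · left; funext a; simp [h, h']
      · exact Or.inr ⟨h', hT.trans Set.subset_union_right⟩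
    · exact Or.inr ⟨h, hS.trans Set.subset_union_left⟩

/-- The factor `G` is absorbed into the coefficients: every `Z e` in use lies inside `S`, which is
disjoint from the variables of `G`. This is why the decomposition records the upper end of each
edge. -/
theorem mul (hZ : ∀ e, C.IsCutEdge e → Z e ⊆ C.varsAt e.1)
    (hF : C.HasCutDecomposition Z S F) (hG : DependsOn G T) (hG0 : ∀ a, 0 ≤ G a)
    (hST : Disjoint S T) : C.HasCutDecomposition Z (S ∪ T) (fun a => F a * G a) := by
  obtain ⟨τ, h1, h2⟩ := hF
  refine ⟨fun e a => τ e a * G a, fun a => ?_, fun e => ⟨fun a => ?_, fun a b hab => ?_, ?_⟩⟩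
  · simp only [h1]
    rw [Finset.sum_mul]
    exact Finset.sum_congr rfl fun e _ => by ring
  · exact mul_nonneg ((h2 e).1 a) (hG0 a)
  · rcases (h2 e).2.2 with h | ⟨h, hS⟩
    · simp [h]
    · simp only [(h2 e).2.1 hab]
      rw [hG fun x hx => hab x fun hxZ => Set.disjoint_left.mp hST (hS (hZ e h hxZ)) hx]
  · rcases (h2 e).2.2 with h | ⟨h, hS⟩
    · left; funext a; simp [h]
    · exact Or.inr ⟨h, hS.trans Set.subset_union_left⟩

theorem single {w c : Fin C.size} (h : C.IsCutEdge (w, c)) (hG : DependsOn G (Z (w, c))ᶜ)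
    (hG0 : ∀ a, 0 ≤ G a) (hw : C.varsAt w ⊆ S) :
    C.HasCutDecomposition Z S (fun a => C.acceptInd c a * G a) := by
  classical
  refine ⟨fun e a => if e = (w, c) then G a else 0, fun a => ?_,
    fun e => ⟨fun a => ?_, fun a b hab => ?_, ?_⟩⟩
  · simp [mul_comm]
  · simp only; split
    · exact hG0 a
    · exact le_rfl
  · by_cases he : e = (w, c)
    · subst he; simpa using hG hab
    · simp [he]
  · by_cases he : e = (w, c)
    · subst he; exact Or.inr ⟨h, hw⟩
    · left; funext a; simp [he]

end HasCutDecomposition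

/-- Here `c` is the larger child of an AND gate `i` and `s` its sibling. If `c` is not heavy, it
still has at least half of more than two thirds of the variables, so it is itself balanced; then `Z`
is exactly its variable set and the sibling is an admissible coefficient. -/
theorem hasCutDecomposition_and [Finite X] {Z : Fin C.size × Fin C.size → Set X}
    (hZ : ∀ e, C.IsCutEdge e → Z e ⊆ C.varsAt e.1)
    (hZ' : ∀ e, C.IsCutEdge e → Nat.card X ≤ 3 * (C.varsAt e.2).ncard → Z e = C.varsAt e.2)
    {i c s : Fin C.size} (hi : C.IsHeavy i) (hcs : Disjoint (C.varsAt c) (C.varsAt s))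
    (hvars : C.varsAt i = C.varsAt c ∪ C.varsAt s)
    (hle : (C.varsAt s).ncard ≤ (C.varsAt c).ncard)
    (hacc : ∀ a, C.acceptInd i a = C.acceptInd c a * C.acceptInd s a)
    (ih : C.IsHeavy c → C.HasCutDecomposition Z (C.varsAt c) (C.acceptInd c)) :
    C.HasCutDecomposition Z (C.varsAt i) (C.acceptInd i) := by
  rw [funext hacc]
  by_cases hc : C.IsHeavy c
  · rw [hvars]
    exact (ih hc).mul hZ (C.acceptInd_dependsOn s) (C.acceptInd_nonneg s) hcs
  · have he : C.IsCutEdge (i, c) := ⟨hi, hc, by simp [hvars]⟩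
    refine .single he ?_ (C.acceptInd_nonneg s) subset_rfl
    have hcard : Nat.card X ≤ 3 * (C.varsAt c).ncard := by
      have := Set.ncard_union_le (C.varsAt c) (C.varsAt s)
      rw [← hvars] at this
      unfold IsHeavy at hi
      omega
    rw [hZ' _ he hcard]
    exact (C.acceptInd_dependsOn s).mono (Set.subset_compl_iff_disjoint_left.mpr hcs)

/-- Induction on the gate. A light child of a heavy OR gate may have very few variables, but its
coefficient is the constant 1, so there `Z` may be any set allowed by `hZ`. Input gates have one
variable and are not heavy. -/
theorem hasCutDecomposition_acceptInd [Finite X] (hC : C.IsDDNNF) (hX : 2 ≤ Nat.card X)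
    {Z : Fin C.size × Fin C.size → Set X}
    (hZ : ∀ e, C.IsCutEdge e → Z e ⊆ C.varsAt e.1)
    (hZ' : ∀ e, C.IsCutEdge e → Nat.card X ≤ 3 * (C.varsAt e.2).ncard → Z e = C.varsAt e.2)
    (i : Fin C.size) (hi : C.IsHeavy i) :
    C.HasCutDecomposition Z (C.varsAt i) (C.acceptInd i) := by
  obtain ⟨i, hlt⟩ := i
  induction i using Nat.strong_induction_on with
  | _ i ih =>
    cases h : C.gate ⟨i, hlt⟩ with
    | pos x =>
      exfalso
      unfold IsHeavy at hi
      rw [varsAt] at hi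
      simp only [h, Set.ncard_singleton] at hi
      omega
    | neg x =>
      exfalso
      unfold IsHeavy at hi
      rw [varsAt] at hi
      simp only [h, Set.ncard_singleton] at hi
      omega
    | and l r =>
      have hd := hC.1 _ l r h
      have ihl := ih l l.isLt (l.isLt.trans hlt)
      have ihr := ih r r.isLt (r.isLt.trans hlt)
      rcases le_total (C.varsAt (C.child ⟨i, hlt⟩ r)).ncard
        (C.varsAt (C.child ⟨i, hlt⟩ l)).ncard with hle | hle
      · exact hasCutDecomposition_and hZ hZ' hi hd (varsAt_and h) hle (acceptInd_and h) ihl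
      · refine hasCutDecomposition_and hZ hZ' hi hd.symm ?_ hle (fun a => ?_) ihr
        · rw [varsAt_and h, Set.union_comm]
        · rw [acceptInd_and h, mul_comm]
    | or l r =>
      have key : ∀ j : Fin i, C.varsAt (C.child ⟨i, hlt⟩ j) ⊆ C.varsAt ⟨i, hlt⟩ →
          C.HasCutDecomposition Z (C.varsAt ⟨i, hlt⟩) (C.acceptInd (C.child ⟨i, hlt⟩ j)) := by
        intro j hj
        by_cases hh : C.IsHeavy (C.child ⟨i, hlt⟩ j)
        · obtain ⟨τ, h1, h2⟩ := ih j j.isLt (j.isLt.trans hlt) hh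
          exact ⟨τ, h1, fun e => ⟨(h2 e).1, (h2 e).2.1, (h2 e).2.2.imp id
            fun h => ⟨h.1, h.2.trans hj⟩⟩⟩
        · have := HasCutDecomposition.single (Z := Z) (S := C.varsAt ⟨i, hlt⟩) (G := fun _ => 1)
            (w := ⟨i, hlt⟩) (c := C.child ⟨i, hlt⟩ j) ⟨hi, hh, hj⟩
            (fun _ _ _ => rfl) (fun _ => zero_le_one) subset_rfl
          simpa using this
      have hv := varsAt_or h
      have hl := key l (by rw [hv]; exact Set.subset_union_left)
      have hr := key r (by rw [hv]; exact Set.subset_union_right)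
      rw [funext (acceptInd_or hC.2 h)]
      simpa using hl.add hr

theorem exists_balanced_between [Finite X] (hX : 2 ≤ Nat.card X) {S T : Set X} (hST : S ⊆ T)
    (hS : 3 * S.ncard ≤ 2 * Nat.card X) (hT : 2 * Nat.card X < 3 * T.ncard) :
    ∃ Z : Set X, S ⊆ Z ∧ Z ⊆ T ∧ Nat.card X ≤ 3 * Z.ncard ∧ 3 * Z.ncard ≤ 2 * Nat.card X ∧
      (Nat.card X ≤ 3 * S.ncard → Z = S) := by
  by_cases h : Nat.card X ≤ 3 * S.ncard
  · exact ⟨S, subset_rfl, hST, h, hS, fun _ => rfl⟩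
  -- The size is a third of the variables, rounded up; it stays below two thirds because there are
  -- at least two variables.
  · obtain ⟨Z, h1, h2, h3⟩ := Set.exists_subsuperset_card_eq (n := (Nat.card X + 2) / 3) hST
      (by omega) (by omega)
    exact ⟨Z, h1, h2, by omega, by omega, fun h' => absurd h' h⟩

/-- The function accepted by a d-DNNF is a sum of at most `size ^ 2` products of functions with
values in the unit interval on the two sides of balanced partitions of the variables. -/
theorem IsDDNNF.exists_balanced_products [Finite X] (hC : C.IsDDNNF) (hX : 2 ≤ Nat.card X) :
    ∃ (Z : Fin C.size × Fin C.size → Set X) (p q : Fin C.size × Fin C.size → Assignment X → ℝ),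
      (∀ a, C.acceptInd C.output a = ∑ e, p e a * q e a) ∧
      ∀ e, Nat.card X ≤ 3 * (Z e).ncard ∧ 3 * (Z e).ncard ≤ 2 * Nat.card X ∧
        DependsOn (p e) (Z e) ∧ DependsOn (q e) (Z e)ᶜ ∧
        (∀ a, |p e a| ≤ 1) ∧ (∀ a, |q e a| ≤ 1) := by
  classical
  have huniv : 2 * Nat.card X < 3 * (Set.univ : Set X).ncard := by
    rw [Set.ncard_univ]; omega
  by_cases hroot : C.IsHeavy C.output
  · have hex : ∀ e, ∃ Z : Set X, Nat.card X ≤ 3 * Z.ncard ∧ 3 * Z.ncard ≤ 2 * Nat.card X ∧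
        (C.IsCutEdge e → C.varsAt e.2 ⊆ Z ∧ Z ⊆ C.varsAt e.1 ∧
          (Nat.card X ≤ 3 * (C.varsAt e.2).ncard → Z = C.varsAt e.2)) := by
      intro e
      by_cases he : C.IsCutEdge e
      · obtain ⟨Z, h1, h2, h3, h4, h5⟩ :=
          exists_balanced_between hX he.2.2 (not_lt.mp he.2.1) he.1
        exact ⟨Z, h3, h4, fun _ => ⟨h1, h2, h5⟩⟩
      · obtain ⟨Z, h1, h2, h3, h4, h5⟩ :=
          exists_balanced_between hX (Set.empty_subset Set.univ) (by simp) huniv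
        exact ⟨Z, h3, h4, fun h => absurd h he⟩
    choose Z hZ1 hZ2 hZ3 using hex
    obtain ⟨τ, h1, h2⟩ := hasCutDecomposition_acceptInd hC hX (Z := Z)
      (fun e he => (hZ3 e he).2.1) (fun e he => (hZ3 e he).2.2) C.output hroot
    -- Edges with unsatisfiable lower end contribute nothing, but their coefficients could be
    -- unbounded, so they are dropped.
    let good : Fin C.size × Fin C.size → Prop := fun e => C.IsCutEdge e ∧ ∃ b, C.AcceptsAt b e.2
    refine ⟨Z, fun e => if good e then C.acceptInd e.2 else 0,
      fun e => if good e then τ e else 0, fun a => ?_, fun e => ⟨hZ1 e, hZ2 e, ?_⟩⟩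
    · rw [h1]
      refine Finset.sum_congr rfl fun e _ => ?_
      by_cases he : good e
      · simp only [he, if_true, mul_comm]
      · simp only [he, if_false, Pi.zero_apply, mul_zero]
        rcases (h2 e).2.2 with h | ⟨h, -⟩
        · simp [h]
        · have : ¬ C.AcceptsAt a e.2 := fun ha => he ⟨h, a, ha⟩
          simp [acceptInd, this]
    · by_cases he : good e
      · simp only [he, if_true]
        have hdep := (C.acceptInd_dependsOn e.2).mono (hZ3 e he.1).1
        refine ⟨hdep, (h2 e).2.1, fun a => ?_, fun a => ?_⟩
        · rw [abs_of_nonneg (C.acceptInd_nonneg _ _)]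
          exact C.acceptInd_le_one _ _
        · rw [abs_of_nonneg ((h2 e).1 a)]
          obtain ⟨b, hb⟩ := he.2
          -- Patching a satisfying assignment of the lower end into `a` on `Z e` leaves the
          -- coefficient unchanged and makes its indicator 1. As all terms are nonnegative, the
          -- coefficient is at most the value of the whole sum at `d`, an indicator.
          let d : Assignment X := fun x => if x ∈ Z e then b x else a x
          have hτ : τ e a = τ e d := (h2 e).2.1 fun x hx => by
            have : x ∉ Z e := hx
            simp [d, this]
          have hacc : C.acceptInd e.2 d = 1 := by
            rw [← show C.acceptInd e.2 b = 1 by simp [acceptInd, hb]]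
            exact hdep fun x hx => by simp [d, hx]
          calc τ e a = τ e d * C.acceptInd e.2 d := by rw [hacc, hτ, mul_one]
            _ ≤ ∑ e, τ e d * C.acceptInd e.2 d :=
              Finset.single_le_sum (f := fun e => τ e d * C.acceptInd e.2 d)
                (fun e _ => mul_nonneg ((h2 e).1 d) (C.acceptInd_nonneg _ _)) (Finset.mem_univ e)
            _ = C.acceptInd C.output d := (h1 d).symm
            _ ≤ 1 := C.acceptInd_le_one _ _
      · simp only [he, if_false]
        exact ⟨fun _ _ _ => rfl, fun _ _ _ => rfl, by simp, by simp⟩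
  -- If the output is not heavy, its variables fit into one side of a balanced partition and a
  -- single product suffices.
  · obtain ⟨Z, h1, -, h3, h4, -⟩ :=
      exists_balanced_between hX (Set.subset_univ (C.varsAt C.output)) (not_lt.mp hroot) huniv
    refine ⟨fun _ => Z, fun e => if e = (C.output, C.output) then C.acceptInd C.output else 0,
      fun _ _ => 1, fun a => ?_, fun e => ⟨h3, h4, ?_, fun _ _ _ => rfl, fun a => ?_, by simp⟩⟩
    · simp [ite_apply]
    · by_cases he : e = (C.output, C.output)
      · simpa [he] using (C.acceptInd_dependsOn C.output).mono h1
      · simp only [he, if_false]; exact fun _ _ _ => rfl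
    · by_cases he : e = (C.output, C.output)
      · simp only [he, if_true]
        rw [abs_of_nonneg (C.acceptInd_nonneg _ _)]
        exact C.acceptInd_le_one _ _
      · simp [he]

end NNF

/-! ### Characters and Lindsey's lemma -/

section Discrepancy

open Finset

/-- The nontrivial character of the field with two elements. -/
noncomputable def signChar (z : ZMod 2) : ℝ := if z = 0 then 1 else -1

theorem signChar_zero : signChar 0 = 1 := by simp [signChar]

theorem signChar_one : signChar 1 = -1 := by simp [signChar]

theorem signChar_add (z w : ZMod 2) : signChar (z + w) = signChar z * signChar w := by
  have h2 : (1 + 1 : ZMod 2) = 0 := by decide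
  have h : ∀ z : ZMod 2, z = 0 ∨ z = 1 := by decide
  rcases h z with rfl | rfl <;> rcases h w with rfl | rfl <;> simp [signChar, h2]

theorem abs_signChar (z : ZMod 2) : |signChar z| = 1 := by
  unfold signChar; split <;> simp

/-- If `w i = 1`, translating `x` by the `i`-th unit vector flips the sign of every term. -/
theorem sum_signChar_dotProduct {ι : Type*} [Fintype ι] [DecidableEq ι] (w : ι → ZMod 2) :
    ∑ x : ι → ZMod 2, signChar (x ⬝ᵥ w) = if w = 0 then 2 ^ Fintype.card ι else 0 := by
  split_ifs with hw
  · simp [hw, signChar_zero]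
  · obtain ⟨i, hi⟩ := Function.ne_iff.mp hw
    have hi1 : w i = 1 := by
      have : ∀ z : ZMod 2, z ≠ 0 → z = 1 := by decide
      exact this _ hi
    have h := Equiv.sum_comp (Equiv.addRight (Pi.single i (1 : ZMod 2)))
      fun x : ι → ZMod 2 => signChar (x ⬝ᵥ w)
    simp only [Equiv.coe_addRight, add_dotProduct, single_dotProduct, hi1, signChar_add,
      signChar_one, mul_one, mul_neg] at h
    rw [Finset.sum_neg_distrib] at h
    linarith

theorem Matrix.card_filter_mulVec_eq_zero {R C : Type*} [Fintype R] [Fintype C] [DecidableEq R]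
    [DecidableEq C] (B : Matrix R C (ZMod 2)) :
    #{y : C → ZMod 2 | B.mulVec y = 0} * 2 ^ B.rank = 2 ^ Fintype.card C := by
  have h1 : Nat.card (LinearMap.ker B.mulVecLin) = #{y : C → ZMod 2 | B.mulVec y = 0} :=
    Nat.subtype_card _ (by simp)
  have h2 := Module.natCard_eq_pow_finrank (K := ZMod 2) (V := LinearMap.ker B.mulVecLin)
  have h3 := LinearMap.finrank_range_add_finrank_ker B.mulVecLin
  rw [Module.finrank_fintype_fun_eq_card] at h3
  rw [← h1, h2, Nat.card_zmod, ← pow_add, ← h3, Matrix.rank, add_comm]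

/-- Lindsey's lemma over the field with two elements. -/
theorem Matrix.sq_sum_signChar_mul_le {R C : Type*} [Fintype R] [Fintype C] [DecidableEq R]
    [DecidableEq C] (B : Matrix R C (ZMod 2)) (u : (R → ZMod 2) → ℝ) (v : (C → ZMod 2) → ℝ)
    (hu : ∀ x, |u x| ≤ 1) (hv : ∀ y, |v y| ≤ 1) :
    (∑ x, ∑ y, u x * v y * signChar (x ⬝ᵥ B.mulVec y)) ^ 2 * 2 ^ B.rank ≤
      (2 ^ Fintype.card R * 2 ^ Fintype.card C) ^ 2 := by
  -- Expanding the square and summing over `x` first, orthogonality keeps only the pairs with `y +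
  -- z` in the kernel of `B`, whose size is governed by the rank.
  have hG : ∑ x, (∑ y, v y * signChar (x ⬝ᵥ B.mulVec y)) ^ 2 ≤
      2 ^ Fintype.card R * (2 ^ Fintype.card C * (#{y : C → ZMod 2 | B.mulVec y = 0} : ℝ)) := by
    calc ∑ x, (∑ y, v y * signChar (x ⬝ᵥ B.mulVec y)) ^ 2
        = ∑ x, ∑ y, ∑ z, v y * v z * signChar (x ⬝ᵥ B.mulVec (y + z)) := by
          refine sum_congr rfl fun x _ => ?_
          rw [sq, sum_mul_sum]
          refine sum_congr rfl fun y _ => sum_congr rfl fun z _ => ?_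
          rw [Matrix.mulVec_add, dotProduct_add, signChar_add]
          ring
      _ = ∑ y, ∑ z, v y * v z * ∑ x, signChar (x ⬝ᵥ B.mulVec (y + z)) := by
          rw [sum_comm]
          refine sum_congr rfl fun y _ => ?_
          rw [sum_comm]
          exact sum_congr rfl fun z _ => (mul_sum _ _ _).symm
      _ ≤ ∑ y, ∑ z, if B.mulVec (y + z) = 0 then (2 : ℝ) ^ Fintype.card R else 0 := by
          refine sum_le_sum fun y _ => sum_le_sum fun z _ => ?_
          rw [sum_signChar_dotProduct]
          split_ifs
          · have : v y * v z ≤ 1 := by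
              refine (le_abs_self _).trans ?_
              rw [abs_mul]
              exact mul_le_one₀ (hv y) (abs_nonneg _) (hv z)
            nlinarith [pow_pos (two_pos : (0 : ℝ) < 2) (Fintype.card R)]
          · simp
      _ = ∑ y : C → ZMod 2, ∑ z, if B.mulVec z = 0 then (2 : ℝ) ^ Fintype.card R else 0 :=
          sum_congr rfl fun y _ => Equiv.sum_comp (Equiv.addLeft y)
            fun z => if B.mulVec z = 0 then (2 : ℝ) ^ Fintype.card R else 0
      _ = _ := by
          rw [sum_const, ← sum_filter, sum_const]
          simp
          ring
  have hS : (∑ x, ∑ y, u x * v y * signChar (x ⬝ᵥ B.mulVec y)) ^ 2 ≤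
      2 ^ Fintype.card R * ∑ x, (∑ y, v y * signChar (x ⬝ᵥ B.mulVec y)) ^ 2 := by
    have h1 : ∑ x, ∑ y, u x * v y * signChar (x ⬝ᵥ B.mulVec y) =
        ∑ x, u x * ∑ y, v y * signChar (x ⬝ᵥ B.mulVec y) := by
      refine sum_congr rfl fun x _ => ?_
      rw [mul_sum]
      exact sum_congr rfl fun y _ => by ring
    rw [h1]
    refine (sum_mul_sq_le_sq_mul_sq _ _ _).trans ?_
    refine mul_le_mul_of_nonneg_right ?_ (sum_nonneg fun x _ => sq_nonneg _)
    calc ∑ x, u x ^ 2 ≤ ∑ _x : R → ZMod 2, (1 : ℝ) :=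
          sum_le_sum fun x _ => (sq_le_one_iff_abs_le_one _).mpr (hu x)
      _ = 2 ^ Fintype.card R := by simp
  have hcard : (#{y : C → ZMod 2 | B.mulVec y = 0} : ℝ) * 2 ^ B.rank = 2 ^ Fintype.card C := by
    exact_mod_cast B.card_filter_mulVec_eq_zero
  calc _ ≤ 2 ^ Fintype.card R * (2 ^ Fintype.card R * (2 ^ Fintype.card C *
          (#{y : C → ZMod 2 | B.mulVec y = 0} : ℝ))) * 2 ^ B.rank := by
        gcongr
        exact hS.trans (by gcongr)
    _ = 2 ^ Fintype.card R * (2 ^ Fintype.card R * (2 ^ Fintype.card C *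
          ((#{y : C → ZMod 2 | B.mulVec y = 0} : ℝ) * 2 ^ B.rank))) := by ring
    _ = _ := by rw [hcard]; ring

/-! ### Discrepancy of balanced rectangles -/

section Rectangles

variable {n : ℕ}

/-- Extension by zero of a vector indexed by a finset of coordinates. -/
def extendZero (R : Finset (Fin n)) (s : R → ZMod 2) (i : Fin n) : ZMod 2 :=
  if h : i ∈ R then s ⟨i, h⟩ else 0

theorem extendZero_dotProduct (R : Finset (Fin n)) (s : R → ZMod 2) (g : Fin n → ZMod 2) :
    extendZero R s ⬝ᵥ g = s ⬝ᵥ fun i : R => g i := by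
  unfold dotProduct
  rw [← sum_subset (subset_univ R) fun i _ hi => by simp [extendZero, hi], ← sum_coe_sort]
  exact sum_congr rfl fun i _ => by simp [extendZero]

theorem extendZero_dotProduct_mulVec (A : Matrix (Fin n) (Fin n) (ZMod 2))
    (R C : Finset (Fin n)) (s : R → ZMod 2) (t : C → ZMod 2) :
    extendZero R s ⬝ᵥ A.mulVec (extendZero C t) =
      s ⬝ᵥ (A.submatrix (fun i : R => (i : Fin n)) (fun j : C => (j : Fin n))).mulVec t := by
  rw [extendZero_dotProduct]
  congr 1
  funext i
  simp only [Matrix.mulVec]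
  rw [dotProduct_comm, extendZero_dotProduct, dotProduct_comm]
  rfl

/-- The mixed second difference of a bilinear form does not depend on the base point `a`; in
characteristic two all signs are plus. -/
theorem bilinearForm_add_add (A : Matrix (Fin n) (Fin n) (ZMod 2))
    (a : Assignment (Fin n ⊕ Fin n)) (x y : Fin n → ZMod 2) :
    bilinearForm A (a + Sum.elim x (0 : Fin n → ZMod 2) + Sum.elim (0 : Fin n → ZMod 2) y) =
      bilinearForm A (a + Sum.elim x (0 : Fin n → ZMod 2)) +
        bilinearForm A (a + Sum.elim (0 : Fin n → ZMod 2) y) +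
          bilinearForm A a + x ⬝ᵥ A.mulVec y := by
  have h2 : ∀ z : ZMod 2, z + z = 0 := by decide
  let a₁ : Fin n → ZMod 2 := fun i => a (Sum.inl i)
  let a₂ : Fin n → ZMod 2 := fun i => a (Sum.inr i)
  change (a₁ + x + 0) ⬝ᵥ A.mulVec (a₂ + 0 + y) = (a₁ + x) ⬝ᵥ A.mulVec (a₂ + 0) +
    (a₁ + 0) ⬝ᵥ A.mulVec (a₂ + y) + a₁ ⬝ᵥ A.mulVec a₂ + x ⬝ᵥ A.mulVec y
  simp only [Matrix.mulVec_add, add_dotProduct, dotProduct_add, add_zero]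
  linear_combination -h2 (a₁ ⬝ᵥ A.mulVec a₂)

/-- Around each base point `a`, shift the rows in `R` by `s` and the columns in `C` by `t`. Since
`p` ignores `t` and `q` ignores `s`, the sum over shifts is a Lindsey sum for the submatrix;
Cauchy-Schwarz then averages over `a`. -/
theorem sq_sum_rectangle_le (A : Matrix (Fin n) (Fin n) (ZMod 2)) {Z : Set (Fin n ⊕ Fin n)}
    (R C : Finset (Fin n)) (hR : ∀ i ∈ R, Sum.inl i ∈ Z) (hC : ∀ j ∈ C, Sum.inr j ∉ Z)
    {p q : Assignment (Fin n ⊕ Fin n) → ℝ} (hp : DependsOn p Z) (hq : DependsOn q Zᶜ)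
    (hp1 : ∀ a, |p a| ≤ 1) (hq1 : ∀ a, |q a| ≤ 1) :
    (∑ a, signChar (bilinearForm A a) * (p a * q a)) ^ 2 *
      2 ^ (A.submatrix (fun i : R => (i : Fin n)) (fun j : C => (j : Fin n))).rank ≤
        ((2 : ℝ) ^ (2 * n)) ^ 2 := by
  set B := A.submatrix (fun i : R => (i : Fin n)) (fun j : C => (j : Fin n)) with hB
  set S := ∑ a, signChar (bilinearForm A a) * (p a * q a) with hS
  let σ : (R → ZMod 2) → Assignment (Fin n ⊕ Fin n) := fun s => Sum.elim (extendZero R s) (0 : Fin n → ZMod 2)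
  let ρ : (C → ZMod 2) → Assignment (Fin n ⊕ Fin n) := fun t => Sum.elim (0 : Fin n → ZMod 2) (extendZero C t)
  let u : Assignment (Fin n ⊕ Fin n) → (R → ZMod 2) → ℝ := fun a s =>
    signChar (bilinearForm A (a + σ s)) * p (a + σ s)
  let v : Assignment (Fin n ⊕ Fin n) → (C → ZMod 2) → ℝ := fun a t =>
    signChar (bilinearForm A (a + ρ t)) * q (a + ρ t)
  let T : Assignment (Fin n ⊕ Fin n) → ℝ := fun a =>
    ∑ s, ∑ t, u a s * v a t * signChar (s ⬝ᵥ B.mulVec t)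
  have hpt : ∀ a s t, signChar (bilinearForm A (a + σ s + ρ t)) *
      (p (a + σ s + ρ t) * q (a + σ s + ρ t)) =
        signChar (bilinearForm A a) * (u a s * v a t * signChar (s ⬝ᵥ B.mulVec t)) := by
    intro a s t
    have h1 : p (a + σ s + ρ t) = p (a + σ s) := hp fun z hz => by
      rcases z with i | j
      · simp [ρ]
      · have : j ∉ C := fun h => hC j h hz
        simp [ρ, extendZero, this]
    have h2 : q (a + σ s + ρ t) = q (a + ρ t) := hq fun z hz => by
      rcases z with i | j
      · have : i ∉ R := fun h => hz (hR i h)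
        simp [σ, extendZero, this]
      · simp [σ]
    rw [h1, h2]
    simp only [σ, ρ, bilinearForm_add_add, signChar_add, extendZero_dotProduct_mulVec, u, v]
    ring
  -- Each shift permutes the assignments, so summing over all shifts only multiplies `S` by their
  -- number.
  have havg : (2 ^ Fintype.card R * 2 ^ Fintype.card C) * S =
      ∑ a, signChar (bilinearForm A a) * T a := by
    calc (2 ^ Fintype.card R * 2 ^ Fintype.card C) * S
        = ∑ _s : R → ZMod 2, ∑ _t : C → ZMod 2, S := by simp [mul_assoc]
      _ = ∑ s, ∑ t, ∑ a, signChar (bilinearForm A (a + σ s + ρ t)) *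
            (p (a + σ s + ρ t) * q (a + σ s + ρ t)) := by
          refine sum_congr rfl fun s _ => sum_congr rfl fun t _ => ?_
          rw [hS, ← Equiv.sum_comp (Equiv.addRight (σ s + ρ t))]
          simp only [Equiv.coe_addRight, add_assoc]
      _ = ∑ a, ∑ s, ∑ t, signChar (bilinearForm A (a + σ s + ρ t)) *
            (p (a + σ s + ρ t) * q (a + σ s + ρ t)) := by
          rw [sum_comm]
          rw [sum_congr rfl fun t _ => sum_comm, sum_comm]
          exact sum_congr rfl fun a _ => sum_comm
      _ = _ := by
          simp only [hpt, T, mul_sum]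
  set K : ℝ := 2 ^ Fintype.card R * 2 ^ Fintype.card C with hK
  have hKpos : 0 < K := by positivity
  have hT : ∀ a, T a ^ 2 * 2 ^ B.rank ≤ K ^ 2 := fun a =>
    B.sq_sum_signChar_mul_le (u a) (v a)
      (fun s => by simpa [u, abs_mul, abs_signChar] using hp1 _)
      (fun t => by simpa [v, abs_mul, abs_signChar] using hq1 _)
  have hcard : (Fintype.card (Assignment (Fin n ⊕ Fin n)) : ℝ) = 2 ^ (2 * n) := by
    simp [two_mul]
  have hCS : (∑ a, signChar (bilinearForm A a) * T a) ^ 2 ≤ 2 ^ (2 * n) * ∑ a, T a ^ 2 := by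
    refine (sum_mul_sq_le_sq_mul_sq _ _ _).trans_eq ?_
    congr 1
    rw [← hcard]
    have : ∀ a, signChar (bilinearForm A a) ^ 2 = 1 := fun a => by
      rw [← sq_abs, abs_signChar, one_pow]
    simp only [this, sum_const, card_univ, nsmul_eq_mul, mul_one]
  have hfin : K ^ 2 * (S ^ 2 * 2 ^ B.rank) ≤ K ^ 2 * ((2 : ℝ) ^ (2 * n)) ^ 2 := by
    calc K ^ 2 * (S ^ 2 * 2 ^ B.rank) = (K * S) ^ 2 * 2 ^ B.rank := by ring
      _ ≤ 2 ^ (2 * n) * (∑ a, T a ^ 2) * 2 ^ B.rank := by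
          rw [havg]; gcongr
      _ = 2 ^ (2 * n) * ∑ a, T a ^ 2 * 2 ^ B.rank := by rw [mul_assoc, sum_mul]
      _ ≤ 2 ^ (2 * n) * ∑ _a : Assignment (Fin n ⊕ Fin n), K ^ 2 := by
          gcongr with a; exact hT a
      _ = _ := by
          rw [sum_const, card_univ, nsmul_eq_mul, hcard]; ring
  exact le_of_mul_le_mul_left hfin (by positivity)

theorem exists_large_cross {Z : Set (Fin n ⊕ Fin n)} (h1 : 2 * n ≤ 3 * Z.ncard)
    (h2 : 3 * Z.ncard ≤ 4 * n) :
    ∃ R C : Finset (Fin n), R.card = C.card ∧ n ≤ 6 * R.card ∧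
      ((∀ i ∈ R, Sum.inl i ∈ Z) ∧ (∀ j ∈ C, Sum.inr j ∉ Z) ∨
        (∀ i ∈ R, Sum.inl i ∉ Z) ∧ (∀ j ∈ C, Sum.inr j ∈ Z)) := by
  classical
  let X₁ : Finset (Fin n) := {i | Sum.inl i ∈ Z}
  let X₂ : Finset (Fin n) := {i | Sum.inl i ∉ Z}
  let Y₁ : Finset (Fin n) := {i | Sum.inr i ∈ Z}
  let Y₂ : Finset (Fin n) := {i | Sum.inr i ∉ Z}
  have hX : #X₁ + #X₂ = n := by
    simpa using card_filter_add_card_filter_not (s := (univ : Finset (Fin n)))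
      (fun i => (Sum.inl i : Fin n ⊕ Fin n) ∈ Z)
  have hY : #Y₁ + #Y₂ = n := by
    simpa using card_filter_add_card_filter_not (s := (univ : Finset (Fin n)))
      (fun i => (Sum.inr i : Fin n ⊕ Fin n) ∈ Z)
  have hZ : Z.ncard = #X₁ + #Y₁ := by
    rw [← card_disjSum, ← Set.ncard_coe_finset]
    congr 1
    ext z
    rcases z with i | j <;> simp [X₁, Y₁]
  have key : ∀ S T : Finset (Fin n), n ≤ 6 * #S → n ≤ 6 * #T →
      ∃ R ⊆ S, ∃ C ⊆ T, #R = #C ∧ n ≤ 6 * #R := by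
    intro S T hS hT
    obtain ⟨R, hR, hRc⟩ := exists_subset_card_eq (min_le_left #S #T)
    obtain ⟨C, hC, hCc⟩ := exists_subset_card_eq (min_le_right #S #T)
    exact ⟨R, hR, C, hC, by omega, by omega⟩
  -- If `X₁` has fewer than `n / 6` elements, balance gives `Y₁` at least `n / 2`; if `Y₂` has fewer
  -- than `n / 6`, it gives `X₂` at least `n / 2`. In either case the other pair is large.
  rcases (by omega : (n ≤ 6 * #X₁ ∧ n ≤ 6 * #Y₂) ∨ (n ≤ 6 * #X₂ ∧ n ≤ 6 * #Y₁)) with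
    ⟨hS, hT⟩ | ⟨hS, hT⟩
  · obtain ⟨R, hR, C, hC, h, h'⟩ := key _ _ hS hT
    exact ⟨R, C, h, h', Or.inl ⟨fun i hi => by simpa [X₁] using hR hi,
      fun i hi => by simpa [Y₂] using hC hi⟩⟩
  · obtain ⟨R, hR, C, hC, h, h'⟩ := key _ _ hS hT
    exact ⟨R, C, h, h', Or.inr ⟨fun i hi => by simpa [X₂] using hR hi,
      fun i hi => by simpa [Y₁] using hC hi⟩⟩

/-- Balanced rectangles have small discrepancy with respect to the bilinear form of an
Ajtai-type matrix. -/
theorem IsAjtaiMatrix.abs_sum_rectangle_le {δ : ℝ} (hδ : δ ≤ 1 / 6)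
    {A : Matrix (Fin n) (Fin n) (ZMod 2)} (hA : IsAjtaiMatrix δ A) {Z : Set (Fin n ⊕ Fin n)}
    (h1 : 2 * n ≤ 3 * Z.ncard) (h2 : 3 * Z.ncard ≤ 4 * n)
    {p q : Assignment (Fin n ⊕ Fin n) → ℝ} (hp : DependsOn p Z) (hq : DependsOn q Zᶜ)
    (hp1 : ∀ a, |p a| ≤ 1) (hq1 : ∀ a, |q a| ≤ 1) :
    |∑ a, signChar (bilinearForm A a) * (p a * q a)| *
      (2 : ℝ) ^ (δ / (256 * Real.logb 2 (1 / δ)) ^ 2 * n / 2) ≤ (2 : ℝ) ^ (2 * n) := by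
  obtain ⟨R, C, hRC, hcard, h⟩ := exists_large_cross h1 h2
  have hrank := hA R C hRC (by
    have : (n : ℝ) ≤ 6 * R.card := by exact_mod_cast hcard
    nlinarith [(Nat.cast_nonneg n : (0 : ℝ) ≤ n)])
  set r := (A.submatrix (fun i : R => (i : Fin n)) (fun j : C => (j : Fin n))).rank with hr
  have hsq : (∑ a, signChar (bilinearForm A a) * (p a * q a)) ^ 2 * 2 ^ r ≤
      ((2 : ℝ) ^ (2 * n)) ^ 2 := by
    rcases h with ⟨hR, hC⟩ | ⟨hR, hC⟩
    · exact sq_sum_rectangle_le A R C hR hC hp hq hp1 hq1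
    -- In the opposite orientation, the roles of `p` and `q` are exchanged and `Z` is replaced by
    -- its complement.
    · simp only [mul_comm (p _)]
      exact sq_sum_rectangle_le A (Z := Zᶜ) R C hR (fun j hj => by simpa using hC j hj)
        hq (by simpa using hp) hq1 hp1
  refine le_of_sq_le_sq ?_ (by positivity)
  rw [mul_pow, sq_abs]
  refine le_trans ?_ hsq
  gcongr
  rw [← Real.rpow_mul_natCast two_pos.le, ← Real.rpow_natCast 2 r]
  refine Real.rpow_le_rpow_of_exponent_le one_le_two ?_
  push_cast
  linarith

end Rectangles

end Discrepancy

/-! ### Most matrices are of Ajtai type -/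

section Counting

open Finset

theorem Matrix.card_zmod_two {R C : Type*} [Fintype R] [Fintype C] [DecidableEq R]
    [DecidableEq C] : Fintype.card (Matrix R C (ZMod 2)) = 2 ^ (Fintype.card R * Fintype.card C) := by
  have h : Fintype.card (Matrix R C (ZMod 2)) = Fintype.card (R → C → ZMod 2) :=
    Fintype.card_congr Matrix.of.symm
  rw [h, Fintype.card_fun, Fintype.card_fun, ZMod.card, ← pow_mul, mul_comm]

/-- The map factors through its range, which embeds into `K ^ r` with a linear left inverse. -/
theorem Matrix.exists_eq_mul_of_rank_le {K R C : Type*} [Field K] [Fintype R] [Fintype C]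
    [DecidableEq R] [DecidableEq C] {r : ℕ} (M : Matrix R C K) (h : M.rank ≤ r) :
    ∃ (P : Matrix R (Fin r) K) (Q : Matrix (Fin r) C K), M = P * Q := by
  have hrank : Module.finrank K (LinearMap.range M.mulVecLin) ≤ Module.finrank K (Fin r → K) := by
    simpa [Matrix.rank] using h
  obtain ⟨e, he⟩ := finrank_le_iff_exists_linearMap.mp hrank
  obtain ⟨g, hg⟩ := e.exists_leftInverse_of_injective (LinearMap.ker_eq_bot.mpr he)
  refine ⟨LinearMap.toMatrix' ((LinearMap.range M.mulVecLin).subtype ∘ₗ g),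
    LinearMap.toMatrix' (e ∘ₗ M.mulVecLin.rangeRestrict), ?_⟩
  rw [← LinearMap.toMatrix'_comp, LinearMap.comp_assoc, ← LinearMap.comp_assoc _ e g, hg,
    LinearMap.id_comp, LinearMap.subtype_comp_codRestrict]
  exact (LinearMap.toMatrix'_toLin' M).symm

theorem Matrix.card_filter_rank_le {R C : Type*} [Fintype R] [Fintype C] [DecidableEq R]
    [DecidableEq C] (r : ℕ) :
    #{M : Matrix R C (ZMod 2) | M.rank ≤ r} ≤ 2 ^ (Fintype.card R * r + r * Fintype.card C) := by
  classical
  calc #{M : Matrix R C (ZMod 2) | M.rank ≤ r}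
      ≤ #(univ.image fun PQ : Matrix R (Fin r) (ZMod 2) × Matrix (Fin r) C (ZMod 2) =>
          PQ.1 * PQ.2) := by
        refine card_le_card fun M hM => ?_
        obtain ⟨P, Q, h⟩ := M.exists_eq_mul_of_rank_le (mem_filter.mp hM).2
        exact mem_image.mpr ⟨(P, Q), mem_univ _, h.symm⟩
    _ ≤ _ := card_image_le
    _ = _ := by
        rw [card_univ, Fintype.card_prod, Matrix.card_zmod_two, Matrix.card_zmod_two,
          Fintype.card_fin, ← pow_add]

/-- The entries outside `R × C` are free, so only the choices of the low-rank block need counting.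
-/
theorem Matrix.card_filter_rank_submatrix_le {n : ℕ} (R C : Finset (Fin n)) (r : ℕ) :
    #{A : Matrix (Fin n) (Fin n) (ZMod 2) |
        (A.submatrix (fun i : R => (i : Fin n)) (fun j : C => (j : Fin n))).rank ≤ r} *
      2 ^ (#R * #C) ≤ 2 ^ (n * n + (#R * r + r * #C)) := by
  classical
  let D : Finset (Fin n × Fin n) := (R ×ˢ C)ᶜ
  have hinj : #{A : Matrix (Fin n) (Fin n) (ZMod 2) |
        (A.submatrix (fun i : R => (i : Fin n)) (fun j : C => (j : Fin n))).rank ≤ r} ≤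
      #(({M : Matrix R C (ZMod 2) | M.rank ≤ r} : Finset _) ×ˢ
        (univ : Finset (D → ZMod 2))) := by
    refine card_le_card_of_injOn
      (fun A => (A.submatrix (fun i : R => (i : Fin n)) (fun j : C => (j : Fin n)),
        fun d : D => A d.1.1 d.1.2)) (fun A hA => ?_) fun A _ B _ hAB => ?_
    · simpa using hA
    · simp only [Prod.mk.injEq] at hAB
      ext i j
      by_cases hij : (i, j) ∈ D
      · exact congrFun hAB.2 ⟨(i, j), hij⟩
      · obtain ⟨hi, hj⟩ : i ∈ R ∧ j ∈ C := by simpa [D] using hij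
        exact congrFun (congrFun hAB.1 ⟨i, hi⟩) ⟨j, hj⟩
  have hD : #D + #R * #C = n * n := by
    have h := card_compl_add_card (R ×ˢ C)
    rwa [card_product, Fintype.card_prod, Fintype.card_fin] at h
  have hlow := Matrix.card_filter_rank_le (R := R) (C := C) r
  rw [Fintype.card_coe, Fintype.card_coe] at hlow
  rw [card_product, card_univ, Fintype.card_fun, ZMod.card, Fintype.card_coe] at hinj
  calc _ ≤ 2 ^ (#R * r + r * #C) * 2 ^ #D * 2 ^ (#R * #C) := by
        gcongr
        exact hinj.trans (by gcongr)
    _ = _ := by rw [mul_assoc, ← pow_add, hD, ← pow_add, add_comm]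

theorem bilinearForm_injective {n : ℕ} :
    Function.Injective (bilinearForm : Matrix (Fin n) (Fin n) (ZMod 2) → _) := by
  intro A B h
  ext i j
  have := congrFun h (Sum.elim (Pi.single i (1 : ZMod 2)) (Pi.single j (1 : ZMod 2)))
  simpa [bilinearForm] using this

-- Union bound: for `k` rows and columns and rank at most `r ≤ k / 4`, the proportion of bad
-- matrices is at most `2 ^ (2 k r - k ^ 2) ≤ 2 ^ (-k ^ 2 / 2)`. With `k ≥ δ n` and `hn` this is at
-- most `2 ^ (-(2 n + 1))`, which beats the number of pairs by a factor of two.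
open Classical in
theorem card_not_isAjtaiMatrix_le {δ : ℝ} (hδ0 : 0 < δ)
    (hδ' : δ / (256 * Real.logb 2 (1 / δ)) ^ 2 ≤ δ / 4) {n : ℕ}
    (hn : 4 * (n : ℝ) + 2 ≤ δ ^ 2 * n ^ 2) :
    2 * #{A : Matrix (Fin n) (Fin n) (ZMod 2) | ¬ IsAjtaiMatrix δ A} ≤ 2 ^ (n * n) := by
  set δ' := δ / (256 * Real.logb 2 (1 / δ)) ^ 2 with hdef
  have hδ'0 : 0 ≤ δ' := by positivity
  set r := ⌊δ' * n⌋₊ with hr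
  have hbad : ∀ RC ∈ ({RC : Finset (Fin n) × Finset (Fin n) |
      #RC.1 = #RC.2 ∧ δ * n ≤ #RC.1} : Finset _),
      #{A : Matrix (Fin n) (Fin n) (ZMod 2) | (A.submatrix (fun i : RC.1 => (i : Fin n))
        (fun j : RC.2 => (j : Fin n))).rank ≤ r} * 2 ^ (2 * n + 1) ≤ 2 ^ (n * n) := by
    rintro ⟨R, C⟩ hRC
    obtain ⟨hcard, hk⟩ := (mem_filter.mp hRC).2
    simp only at hcard hk ⊢
    have h := Matrix.card_filter_rank_submatrix_le R C r
    rw [← hcard] at h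
    set k := #R
    have hrk : 4 * r ≤ k := by
      have h1 : (r : ℝ) ≤ δ' * n := Nat.floor_le (by positivity)
      have h2 : δ' * n ≤ δ / 4 * n := by gcongr
      have h3 : (4 * r : ℝ) ≤ k := by linarith
      exact_mod_cast h3
    have hkn : 4 * n + 2 ≤ k * k := by
      have h1 : (δ * n) ^ 2 ≤ (k : ℝ) ^ 2 := by gcongr
      have h2 : (4 * n + 2 : ℝ) ≤ k * k := by nlinarith
      exact_mod_cast h2
    have hexp : (2 * n + 1) + (k * r + r * k) ≤ k * k := by nlinarith
    have h' : #{A : Matrix (Fin n) (Fin n) (ZMod 2) | (A.submatrix (fun i : R => (i : Fin n))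
        (fun j : C => (j : Fin n))).rank ≤ r} * 2 ^ (2 * n + 1) * 2 ^ (k * r + r * k) ≤
          2 ^ (n * n) * 2 ^ (k * r + r * k) := by
      rw [mul_assoc, ← pow_add, ← pow_add]
      exact (Nat.mul_le_mul_left _ (Nat.pow_le_pow_right two_pos hexp)).trans h
    exact Nat.le_of_mul_le_mul_right h' (by positivity)
  have hsub : ({A : Matrix (Fin n) (Fin n) (ZMod 2) | ¬ IsAjtaiMatrix δ A} : Finset _) ⊆
      ({RC : Finset (Fin n) × Finset (Fin n) | #RC.1 = #RC.2 ∧ δ * n ≤ #RC.1} : Finset _).biUnion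
        fun RC => {A : Matrix (Fin n) (Fin n) (ZMod 2) | (A.submatrix
          (fun i : RC.1 => (i : Fin n)) (fun j : RC.2 => (j : Fin n))).rank ≤ r} := by
    intro A hA
    have hA := (mem_filter.mp hA).2
    unfold IsAjtaiMatrix at hA
    push Not at hA
    obtain ⟨R, C, h1, h2, h3⟩ := hA
    exact mem_biUnion.mpr ⟨(R, C), mem_filter.mpr ⟨mem_univ _, h1, h2⟩,
      mem_filter.mpr ⟨mem_univ _, Nat.le_floor h3.le⟩⟩
  have hpairs : #({RC : Finset (Fin n) × Finset (Fin n) | #RC.1 = #RC.2 ∧ δ * n ≤ #RC.1} :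
      Finset _) ≤ 2 ^ (2 * n) := by
    refine (card_le_univ _).trans_eq ?_
    simp [two_mul, pow_add]
  have hsum := (card_le_card hsub).trans card_biUnion_le
  refine Nat.le_of_mul_le_mul_right (c := 2 ^ (2 * n)) ?_ (by positivity)
  calc 2 * #{A : Matrix (Fin n) (Fin n) (ZMod 2) | ¬ IsAjtaiMatrix δ A} * 2 ^ (2 * n)
      = #{A : Matrix (Fin n) (Fin n) (ZMod 2) | ¬ IsAjtaiMatrix δ A} * 2 ^ (2 * n + 1) := by ring
    _ ≤ _ := Nat.mul_le_mul_right _ hsum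
    _ = _ := sum_mul _ _ _
    _ ≤ _ := sum_le_card_nsmul _ _ _ hbad
    _ = _ := smul_eq_mul _ _
    _ ≤ 2 ^ (2 * n) * 2 ^ (n * n) := Nat.mul_le_mul_right _ hpairs
    _ = _ := mul_comm _ _

theorem two_pow_le_two_mul_ncard_ajtaiForms {δ : ℝ} (hδ0 : 0 < δ)
    (hδ' : δ / (256 * Real.logb 2 (1 / δ)) ^ 2 ≤ δ / 4) {n : ℕ}
    (hn : 4 * (n : ℝ) + 2 ≤ δ ^ 2 * n ^ 2) :
    2 ^ (n * n) ≤ 2 * (ajtaiForms δ n).ncard := by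
  classical
  have h1 : ajtaiForms δ n = bilinearForm ''
      (({A : Matrix (Fin n) (Fin n) (ZMod 2) | IsAjtaiMatrix δ A} : Finset _) : Set _) := by
    ext f
    simp [ajtaiForms, eq_comm]
  rw [h1, Set.ncard_image_of_injective _ bilinearForm_injective, Set.ncard_coe_finset]
  have h2 := card_not_isAjtaiMatrix_le hδ0 hδ' hn
  have h3 := card_filter_add_card_filter_not
    (s := (univ : Finset (Matrix (Fin n) (Fin n) (ZMod 2)))) fun A => IsAjtaiMatrix δ A
  rw [card_univ, Matrix.card_zmod_two, Fintype.card_fin] at h3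
  omega

end Counting

/-! ### From correlation to circuit size -/

section LowerBound

open Finset

theorem toOuterMeasure_uniformDist {X : Type*} [Fintype X] [DecidableEq X]
    (S : Set (Assignment X)) [DecidablePred (· ∈ S)] :
    ((uniformDist X).toOuterMeasure S).toReal =
      (#{a : Assignment X | a ∈ S} : ℝ) / Fintype.card (Assignment X) := by
  rw [uniformDist, PMF.toOuterMeasure_uniformOfFintype_apply, ENNReal.toReal_div,
    ENNReal.toReal_natCast, ENNReal.toReal_natCast, Fintype.card_subtype]

/-- A weak approximation correlates with the approximated function. -/
theorem IsWeakApprox.le_sum_signChar {X : Type*} [Fintype X] [DecidableEq X] {ε : ℝ}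
    {f g : BoolFun X} (h : IsWeakApprox (uniformDist X) ε f g) :
    (1 - 2 * ε) * 2 ^ Fintype.card X ≤ ∑ a, signChar (f a) * signChar (g a) := by
  classical
  have hcard : (Fintype.card (Assignment X) : ℝ) = 2 ^ Fintype.card X := by simp
  have hpos : (0 : ℝ) < 2 ^ Fintype.card X := by positivity
  unfold IsWeakApprox at h
  rw [toOuterMeasure_uniformDist, hcard, div_le_iff₀ hpos] at h
  have hpt : ∀ a, signChar (f a) * signChar (g a) =
      1 - 2 * if f a ≠ g a then (1 : ℝ) else 0 := by
    intro a
    have h01 : ∀ z : ZMod 2, z = 0 ∨ z = 1 := by decide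
    rcases h01 (f a) with hf | hf <;> rcases h01 (g a) with hg | hg <;>
      norm_num [hf, hg, signChar_zero, signChar_one]
  rw [sum_congr rfl fun a _ => hpt a, sum_sub_distrib, ← mul_sum, sum_boole]
  simp only [sum_const, card_univ, nsmul_eq_mul, mul_one, hcard]
  simp only [Set.mem_ofPred_eq] at h
  linarith

theorem NNF.Encodes.signChar_eq {X : Type*} {D : NNF X} {g : BoolFun X} (h : D.Encodes g)
    (a : Assignment X) : signChar (g a) = 1 - 2 * D.acceptInd D.output a := by
  have h01 : ∀ z : ZMod 2, z = 0 ∨ z = 1 := by decide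
  have ha := h a
  rcases h01 (g a) with hg | hg
  · have : ¬ D.AcceptsAt a D.output := fun h' => by simp [hg] at ha; exact ha h'
    norm_num [hg, signChar_zero, NNF.acceptInd, this]
  · have : D.AcceptsAt a D.output := ha.mpr hg
    norm_num [hg, signChar_one, NNF.acceptInd, this]

theorem NNF.IsDDNNF.le_three_mul_size_sq {n : ℕ} (hn : 1 ≤ n) {δ ε : ℝ} (hδ : δ ≤ 1 / 6)
    {f g : BoolFun (Fin n ⊕ Fin n)} (hf : f ∈ ajtaiForms δ n)
    (hg : IsWeakApprox (uniformDist (Fin n ⊕ Fin n)) ε f g)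
    {D : NNF (Fin n ⊕ Fin n)} (hD : D.IsDDNNF) (hDg : D.Encodes g) :
    (1 - 2 * ε) * (2 : ℝ) ^ (δ / (256 * Real.logb 2 (1 / δ)) ^ 2 * n / 2) ≤
      3 * (D.size : ℝ) ^ 2 := by
  obtain ⟨A, hA, rfl⟩ := hf
  have hX : Nat.card (Fin n ⊕ Fin n) = 2 * n := by simp [two_mul]
  obtain ⟨Z, p, q, hsum, hpq⟩ := hD.exists_balanced_products (by omega)
  rw [hX] at hpq
  set M : ℝ := (2 : ℝ) ^ (δ / (256 * Real.logb 2 (1 / δ)) ^ 2 * n / 2) with hM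
  have hM0 : 0 < M := by positivity
  have hrect : ∀ e, |∑ a, signChar (bilinearForm A a) * (p e a * q e a)| * M ≤
      (2 : ℝ) ^ (2 * n) := fun e =>
    hA.abs_sum_rectangle_le hδ (hpq e).1 (by have := (hpq e).2.1; omega) (hpq e).2.2.1
      (hpq e).2.2.2.1 (hpq e).2.2.2.2.1 (hpq e).2.2.2.2.2
  -- The sign of `g` is 1 minus twice the indicator; the constant 1 is itself a product, for any
  -- balanced partition, so its correlation is bounded in the same way.
  have hall : |∑ a, signChar (bilinearForm A a)| * M ≤ (2 : ℝ) ^ (2 * n) := by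
    have h := hA.abs_sum_rectangle_le hδ (p := fun _ => 1) (q := fun _ => 1)
      (hpq (D.output, D.output)).1 (by have := (hpq (D.output, D.output)).2.1; omega)
      (fun _ _ _ => rfl) (fun _ _ _ => rfl) (by simp) (by simp)
    simpa only [mul_one] using h
  have hsize : (1 : ℝ) ≤ (D.size : ℝ) ^ 2 := by
    have : 1 ≤ D.size := D.output.pos
    exact one_le_pow₀ (by exact_mod_cast this)
  have hcorr := hg.le_sum_signChar
  have hexpand : ∑ a, signChar (bilinearForm A a) * signChar (g a) =
      ∑ a, signChar (bilinearForm A a) -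
        2 * ∑ e, ∑ a, signChar (bilinearForm A a) * (p e a * q e a) := by
    rw [sum_comm, mul_sum, ← sum_sub_distrib]
    refine sum_congr rfl fun a _ => ?_
    rw [hDg.signChar_eq, hsum, ← mul_sum]
    ring
  have hcard : Fintype.card (Fin n ⊕ Fin n) = 2 * n := by simp [two_mul]
  rw [hexpand, hcard] at hcorr
  have hE : |∑ e, ∑ a, signChar (bilinearForm A a) * (p e a * q e a)| * M ≤
      (D.size : ℝ) ^ 2 * 2 ^ (2 * n) := by
    calc _ ≤ (∑ e, |∑ a, signChar (bilinearForm A a) * (p e a * q e a)|) * M := by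
          gcongr; exact abs_sum_le_sum_abs _ _
      _ = ∑ e, |∑ a, signChar (bilinearForm A a) * (p e a * q e a)| * M := sum_mul _ _ _
      _ ≤ ∑ _e : Fin D.size × Fin D.size, (2 : ℝ) ^ (2 * n) := sum_le_sum fun e _ => hrect e
      _ = _ := by simp [sq]
  have hpow : (0 : ℝ) < 2 ^ (2 * n) := by positivity
  refine le_of_mul_le_mul_right ?_ hpow
  calc (1 - 2 * ε) * M * 2 ^ (2 * n) = ((1 - 2 * ε) * 2 ^ (2 * n)) * M := by ring
    _ ≤ (|∑ a, signChar (bilinearForm A a)| +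
          2 * |∑ e, ∑ a, signChar (bilinearForm A a) * (p e a * q e a)|) * M := by
        refine mul_le_mul_of_nonneg_right (hcorr.trans ?_) hM0.le
        have h1 := le_abs_self (∑ a, signChar (bilinearForm A a))
        have h2 := neg_abs_le (∑ e, ∑ a, signChar (bilinearForm A a) * (p e a * q e a))
        linarith
    _ ≤ 2 ^ (2 * n) + 2 * ((D.size : ℝ) ^ 2 * 2 ^ (2 * n)) := by
        rw [add_mul, mul_assoc 2]
        gcongr
    _ ≤ 3 * (D.size : ℝ) ^ 2 * 2 ^ (2 * n) := by nlinarith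

end LowerBound

theorem theorem2 (ε : ℝ) (hε0 : 0 ≤ ε) (hε : ε < 1 / 2)
    (δ : ℝ) (hδ0 : 0 < δ) (hδ1 : δ ≤ 1 / 2) (hδ : δ * Real.logb 2 (1 / δ) ^ 2 ≤ 2⁻¹ ^ 16) :
    -- for all large `n`, the class has exponentially many members on `2 n` variables
    (∃ c : ℝ, 0 < c ∧ ∃ n₀ : ℕ, ∀ n : ℕ, n₀ ≤ n →
      (2 : ℝ) ^ (c * (n : ℝ)) ≤ ((ajtaiForms δ n).ncard : ℝ)) ∧
    -- every d-DNNF for a weak approximation has size exponential in the number of variables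
    (∃ c : ℝ, 0 < c ∧ ∃ n₀ : ℕ, ∀ n : ℕ, n₀ ≤ n →
      ∀ f ∈ ajtaiForms δ n, ∀ g : BoolFun (Fin n ⊕ Fin n),
        IsWeakApprox (uniformDist (Fin n ⊕ Fin n)) ε f g →
        ∀ D : NNF (Fin n ⊕ Fin n), D.IsDDNNF → D.Encodes g →
          (2 : ℝ) ^ (c * (2 * (n : ℝ))) ≤ (D.size : ℝ)) := by
  have hlog : 1 ≤ Real.logb 2 (1 / δ) := by
    rw [Real.le_logb_iff_rpow_le one_lt_two (by positivity), Real.rpow_one, le_div_iff₀ hδ0]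
    linarith
  have hδ6 : δ ≤ 1 / 6 := by
    have h1 : δ * 1 ≤ δ * Real.logb 2 (1 / δ) ^ 2 := by
      gcongr; exact one_le_pow₀ hlog
    norm_num at hδ h1 ⊢
    linarith
  set δ' := δ / (256 * Real.logb 2 (1 / δ)) ^ 2 with hdef
  have hδ'0 : 0 < δ' := by positivity
  have hδ' : δ' ≤ δ / 4 := by
    rw [hdef]
    gcongr
    nlinarith
  constructor
  -- For `n ≥ 6 / δ ^ 2` the counting hypothesis follows from `4 n + 2 ≤ 6 n`; `n ≥ 2` gives `n + 1
  -- ≤ n ^ 2`.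
  · refine ⟨1, one_pos, ⌈6 / δ ^ 2⌉₊ + 2, fun n hn => ?_⟩
    have hn2 : 2 ≤ n := by omega
    have hnδ : 6 / δ ^ 2 ≤ n := (Nat.le_ceil _).trans (by exact_mod_cast (by omega))
    have hn1 : (1 : ℝ) ≤ n := by exact_mod_cast (by omega)
    rw [div_le_iff₀ (by positivity)] at hnδ
    have h := two_pow_le_two_mul_ncard_ajtaiForms hδ0 hδ' (n := n) (by nlinarith)
    have h2 : 2 * 2 ^ n ≤ 2 * (ajtaiForms δ n).ncard := by
      refine le_trans ?_ h
      rw [← pow_succ']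
      exact Nat.pow_le_pow_right two_pos (by nlinarith)
    rw [one_mul, Real.rpow_natCast]
    exact_mod_cast Nat.le_of_mul_le_mul_left h2 two_pos
  · set η := (1 - 2 * ε) / 3 with hη
    have hη0 : 0 < η := by
      rw [hη]; linarith
    -- The rate `δ' / 2` for the squared size is halved three times: to absorb `η` for large `n`,
    -- for the square root, and because the exponent counts `2 n` variables. The added 1 ensures `n
    -- ≥ 1`.
    refine ⟨δ' / 16, by positivity, ⌈-Real.logb 2 η / (δ' / 4)⌉₊ + 1, fun n hn f hf g hg D hD hDg => ?_⟩
    have h := NNF.IsDDNNF.le_three_mul_size_sq (by omega) hδ6 hf hg hD hDg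
    have hnη : -Real.logb 2 η / (δ' / 4) ≤ n :=
      (Nat.le_ceil _).trans (by exact_mod_cast (by omega))
    rw [div_le_iff₀ (by positivity)] at hnη
    refine le_of_sq_le_sq ?_ (Nat.cast_nonneg _)
    calc ((2 : ℝ) ^ (δ' / 16 * (2 * (n : ℝ)))) ^ 2 = 2 ^ (δ' * n / 4) := by
          rw [← Real.rpow_mul_natCast two_pos.le]
          congr 1
          push_cast
          ring
      _ ≤ 2 ^ (Real.logb 2 η + δ' * n / 2) :=
          Real.rpow_le_rpow_of_exponent_le one_le_two (by linarith)
      _ = η * 2 ^ (δ' * n / 2) := by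
          rw [Real.rpow_add two_pos, Real.rpow_logb two_pos (by norm_num) hη0]
      _ ≤ (D.size : ℝ) ^ 2 := by
          rw [hη]
          linarith
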